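/- Let $M$ be a smooth manifold of dimension $2m$ with a smooth pseudo-Riemannian metric $g$, and let $r$ be a smooth spacelike reflection: a field of endomorphisms of $TM$ with $r^2=1$, $g(r\cdot,r\cdot)=g$, and $g_R(u,v):=g(u,rv)$ positive definite. Let $(x^\mu)$ be local coordinates in which the reflected coordinate fields $\partial_{r\nu}:=r\partial_\nu=r^\sigma{}_\nu\partial_\sigma$ commute with the coordinate fields, $[\partial_\mu,\partial_{r\nu}]=0$ (that is, $\partial_\mu r^\sigma{}_\nu=0$). Let $(e_a)$ be a smooth frame on the coordinate domain that is orthonormal for both $g$ and $g_R$, with $g(e_a,e_b)=g_a\delta_{ab}$, $g_a=\pm1$, components $e_a{}^\mu$ and dual coframe $e^b{}_\mu$; write $g^a=g_a$, $\partial_a=e_a{}^\nu\partial_\nu$, $\partial_{ra}=e_a{}^\nu r^\sigma{}_\nu\partial_\sigma$, and $g^{b\kappa}=e^b{}_\lambda g^{\lambda\kappa}$. Let $\gamma^a\in M_{2^m}(\mathbb C)$ be unitary matrices with $\gamma^a\gamma^b+\gamma^b\gamma^a=2g_a\delta_{ab}$, and $K=K^\dagger$ a unitary matrix with $K\gamma^aK^{-1}=(\gamma^a)^\dagger$.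 Put $\gamma^\mu=e_a{}^\mu\gamma^a$, $\gamma_b=g_b\gamma^b$, $\tilde\gamma^a=K\gamma^a$, $\tilde\gamma^\mu=K\gamma^\mu$, and $\tilde\gamma_b=\tilde\gamma^b$ (index lowered with $g_R$). With $\Gamma^\lambda{}_{\mu\nu}$ and $\Gamma^\lambda_{R\,\mu\nu}$ the Christoffel symbols of $g$ and $g_R$, let $$\Gamma^b{}_{\mu a}=e_a{}^\nu\Gamma^\lambda{}_{\mu\nu}e^b{}_\lambda-e_a{}^\nu\partial_\mu e^b{}_\nu,\qquad \Gamma^b_{R\,\mu a}=e_a{}^\nu\Gamma^\lambda_{R\,\mu\nu}e^b{}_\lambda-e_a{}^\nu\partial_\mu e^b{}_\nu,\qquad \tilde\Gamma^b{}_{\mu a}=g^ag^b\,\Gamma^b{}_{\mu a}.$$ Fix a sign convention $s\in\{1,-1\}$ for the spin connection and, acting on smooth local spinor fields $\psi$ with values in $\mathbb C^{2^m}$, define $$D^K=-i\gamma^\mu\Big(\partial_\mu+\tfrac s4\Gamma^b{}_{\mu a}\gamma^a\gamma_b\Big),\qquad D=KD^K,\qquad \tilde\nabla_\mu^{R,S}=\partial_\mu+\tfrac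 s4\tilde\Gamma^b{}_{\mu a}\tilde\gamma^a\tilde\gamma_b .$$ Then $D=-i\tilde\gamma^\mu\tilde\nabla_\mu^{R,S}$ on the coordinate domain, and for every $\mu$ $$\tilde\nabla_\mu^{R,S}=\partial_\mu+\tfrac s4\Gamma^b_{R\,\mu a}\tilde\gamma^a\tilde\gamma_b+\tfrac s4K^b{}_{\mu a}\tilde\gamma^a\tilde\gamma_b,$$ $$K^b{}_{\mu a}=g^b\Big(\tfrac12g^{b\kappa}\big(\partial_{ra}g_{\mu\kappa}-\partial_ag^R_{\mu\kappa}\big)-\partial_\mu g_a\Big).$$ (The frame sign $g^b$ multiplies the whole bracket and is not summed with $g^{b\kappa}$.) -/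

import Mathlib

open scoped Manifold ContDiff Matrix

noncomputable section

/-- The model space `ℝ^{2m}` of coordinates. -/
abbrev CoordSpace (m : ℕ) := EuclideanSpace ℝ (Fin (2 * m))

/-- The fibre `ℂ^{2^m}` of the spinor bundle in a local gauge. -/
abbrev Spinor (m : ℕ) := Fin (2 ^ m) → ℂ

/-- Linear operators on `ℂ^{2^m}`, as matrices. The adjoint `†` is the conjugate transpose. -/
abbrev SpinMat (m : ℕ) := Matrix (Fin (2 ^ m)) (Fin (2 ^ m)) ℂ

/-- Matrix-valued functions of the coordinates. -/
abbrev CoordMat (m : ℕ) := CoordSpace m → Matrix (Fin (2 * m)) (Fin (2 * m)) ℝ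

section Manifold

variable {m : ℕ} {M : Type*} [TopologicalSpace M] [ChartedSpace (CoordSpace m) M]

/-- Fields of bilinear forms on the tangent spaces. -/
abbrev FormField (m : ℕ) (M : Type*) [TopologicalSpace M] [ChartedSpace (CoordSpace m) M] :=
  ∀ x : M, LinearMap.BilinForm ℝ (TangentSpace (𝓡 (2 * m)) x)

/-- Fields of endomorphisms of the tangent spaces. -/
abbrev EndField (m : ℕ) (M : Type*) [TopologicalSpace M] [ChartedSpace (CoordSpace m) M] :=
  ∀ x : M, TangentSpace (𝓡 (2 * m)) x →ₗ[ℝ] TangentSpace (𝓡 (2 * m)) x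

/-- Families of `2m` vector fields. -/
abbrev FrameField (m : ℕ) (M : Type*) [TopologicalSpace M] [ChartedSpace (CoordSpace m) M] :=
  Fin (2 * m) → ∀ x : M, TangentSpace (𝓡 (2 * m)) x

/-- The coordinate vector `∂_μ` of the chart `φ` at the point with coordinates `y`. -/
def coordVec (φ : OpenPartialHomeomorph M (CoordSpace m)) (μ : Fin (2 * m)) (y : CoordSpace m) :
    TangentSpace (𝓡 (2 * m)) (φ.symm y) :=
  mfderiv 𝓘(ℝ, CoordSpace m) (𝓡 (2 * m)) φ.symm y (EuclideanSpace.single μ (1 : ℝ))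

/-- The component `dx^μ(v)` of a tangent vector `v` at the point with coordinates `y`. -/
def coordComp (φ : OpenPartialHomeomorph M (CoordSpace m)) (μ : Fin (2 * m)) (y : CoordSpace m)
    (v : TangentSpace (𝓡 (2 * m)) (φ.symm y)) : ℝ :=
  (show CoordSpace m from mfderiv (𝓡 (2 * m)) 𝓘(ℝ, CoordSpace m) φ (φ.symm y) v) μ

/-- The components `g_{μν} = g(∂_μ, ∂_ν)`. -/
def formComp (φ : OpenPartialHomeomorph M (CoordSpace m)) (g : FormField m M) : CoordMat m :=
  fun y => Matrix.of fun μ ν => g (φ.symm y) (coordVec φ μ y) (coordVec φ ν y)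

/-- The components `r^μ_ν = dx^μ(r ∂_ν)`. -/
def endComp (φ : OpenPartialHomeomorph M (CoordSpace m)) (r : EndField m M) : CoordMat m :=
  fun y => Matrix.of fun μ ν => coordComp φ μ y (r (φ.symm y) (coordVec φ ν y))

/-- The components `e_a^μ = dx^μ(e_a)`; the row index is `μ`, the column index is `a`. -/
def frameComp (φ : OpenPartialHomeomorph M (CoordSpace m)) (e : FrameField m M) : CoordMat m :=
  fun y => Matrix.of fun μ a => coordComp φ μ y (e a (φ.symm y))

/-- `g` is a smooth pseudo-Riemannian metric. -/
structure IsPseudoRiemannianMetric (g : FormField m M) : Prop where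
  symm : ∀ x u v, g x u v = g x v u
  nondegenerate : ∀ x u, (∀ v, g x u v = 0) → u = 0
  smooth : ∀ φ ∈ IsManifold.maximalAtlas (𝓡 (2 * m)) ∞ M, ∀ μ ν,
    ContDiffOn ℝ ∞ (fun y => formComp φ g y μ ν) φ.target

/-- The form `g_R(u, v) = g(u, r v)`. -/
def reflectedMetric (g : FormField m M) (r : EndField m M) : FormField m M :=
  fun x => (g x).compl₂ (r x)

/-- `r` is a smooth spacelike reflection of `(M, g)`: an isometric involution of `TM` for which
`g_R = g(·, r ·)` is positive definite. -/
structure IsSpacelikeReflection (g : FormField m M) (r : EndField m M) : Prop where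
  involutive : ∀ x v, r x (r x v) = v
  isometry : ∀ x u v, g x (r x u) (r x v) = g x u v
  posDef : ∀ x v, v ≠ 0 → 0 < reflectedMetric g r x v v
  smooth : ∀ φ ∈ IsManifold.maximalAtlas (𝓡 (2 * m)) ∞ M, ∀ μ ν,
    ContDiffOn ℝ ∞ (fun y => endComp φ r y μ ν) φ.target

/-- `e` is a smooth local frame over the domain of the chart `φ`, `g`-orthonormal with signs
`g_a = η a`, and `g_R`-orthonormal. -/
structure IsOrthonormalFrame (φ : OpenPartialHomeomorph M (CoordSpace m)) (g : FormField m M)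
    (r : EndField m M) (η : Fin (2 * m) → ℝ) (e : FrameField m M) : Prop where
  orthonormal : ∀ x ∈ φ.source, ∀ a b, g x (e a x) (e b x) = if a = b then η a else 0
  orthonormal_reflected : ∀ x ∈ φ.source, ∀ a b,
    reflectedMetric g r x (e a x) (e b x) = if a = b then 1 else 0
  smooth : ∀ μ a, ContDiffOn ℝ ∞ (fun y => frameComp φ e y μ a) φ.target

end Manifold

section Coordinates

variable {m : ℕ}

/-- The partial derivative `∂_μ f` at `y`. -/
def pd {F : Type*} [NormedAddCommGroup F] [NormedSpace ℝ F] (μ : Fin (2 * m))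
    (f : CoordSpace m → F) (y : CoordSpace m) : F :=
  fderiv ℝ f y (EuclideanSpace.single μ (1 : ℝ))

/-- The reflected coordinate fields `∂_{rν} = r^σ_ν ∂_σ` commute with the coordinate fields `∂_μ`
on `U`: the components `∂_μ r^σ_ν` of `[∂_μ, ∂_{rν}]` vanish. -/
def ReflectionIntegrable (r : CoordMat m) (U : Set (CoordSpace m)) : Prop :=
  ∀ y ∈ U, ∀ μ ν σ, pd μ (fun z => r z σ ν) y = 0

/-- The Christoffel symbol
`Γ^l_{μν} = ½ g^{lκ} (∂_μ g_{νκ} + ∂_ν g_{μκ} - ∂_κ g_{μν})` of the metric `g`. -/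
def christoffel (g : CoordMat m) (y : CoordSpace m) (l μ ν : Fin (2 * m)) : ℝ :=
  (1 / 2) * ∑ κ, (g y)⁻¹ l κ *
    (pd μ (fun z => g z ν κ) y + pd ν (fun z => g z μ κ) y - pd κ (fun z => g z μ ν) y)

/-- The components `e^b_μ` of the dual coframe; the row index is `b`, the column index is `μ`. -/
def coframe (e : CoordMat m) : CoordMat m := fun y => (e y)⁻¹

/-- `Γ^b_{μa} = e_a^ν Γ^l_{μν} e^b_l - e_a^ν ∂_μ e^b_ν`, where `Γ^l_{μν}` are the Christoffel
symbols of `g`. -/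
def frameChristoffel (g e : CoordMat m) (y : CoordSpace m) (b μ a : Fin (2 * m)) : ℝ :=
  (∑ ν, ∑ l, e y ν a * christoffel g y l μ ν * coframe e y b l)
    - ∑ ν, e y ν a * pd μ (fun z => coframe e z b ν) y

/-- `g_a = g(e_a, e_a)`, as a function of the coordinates. -/
def frameSign (g e : CoordMat m) (a : Fin (2 * m)) (y : CoordSpace m) : ℝ :=
  ∑ μ, ∑ ν, g y μ ν * e y μ a * e y ν a

/-- The derivative `∂_a f = e_a^ν ∂_ν f` along the frame. -/
def frameDeriv (e : CoordMat m) (a : Fin (2 * m)) (f : CoordSpace m → ℝ) (y : CoordSpace m) : ℝ :=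
  ∑ ν, e y ν a * pd ν f y

/-- The derivative `∂_{ra} f = e_a^ν r^σ_ν ∂_σ f` along the reflected frame. -/
def reflectedFrameDeriv (r e : CoordMat m) (a : Fin (2 * m)) (f : CoordSpace m → ℝ)
    (y : CoordSpace m) : ℝ :=
  ∑ ν, ∑ σ, e y ν a * r y σ ν * pd σ f y

/-- The correction term
`K^b_{μa} = g^b (½ g^{bκ} (∂_{ra} g_{μκ} - ∂_a g^R_{μκ}) - ∂_μ g_a)`, where
`g^{bκ} = e^b_l g^{lκ}` and `g^R_{μκ} = g_{μσ} r^σ_κ`; here `gR` stands for `g^R`. The sign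
`g^b = g_b` has its index raised by the identity. -/
def correctionTerm (g gR r e : CoordMat m) (y : CoordSpace m) (b μ a : Fin (2 * m)) : ℝ :=
  frameSign g e b y *
    ((1 / 2) * ∑ κ, (∑ l, coframe e y b l * (g y)⁻¹ l κ) *
        (reflectedFrameDeriv r e a (fun z => g z μ κ) y - frameDeriv e a (fun z => gR z μ κ) y)
      - pd μ (frameSign g e a) y)

/-- `Γ̃^b_{μa}`, defined by `Γ^b_{μa} = g^a g^b Γ̃^b_{μa}`; since `g_a g_b = ±1`, this means
`Γ̃^b_{μa} = g^a g^b Γ^b_{μa}`. -/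
def twistedChristoffel (g e : CoordMat m) (y : CoordSpace m) (b μ a : Fin (2 * m)) : ℝ :=
  frameSign g e a y * frameSign g e b y * frameChristoffel g e y b μ a

end Coordinates

section Dirac

variable {m : ℕ}

/-- `γ` is a system of unitary gamma matrices with `{γ^a, γ^b} = 2 g^{ab}`, `g^{ab}` diagonal with
entries `η a = ±1`, and `K` is a unitary self-adjoint operator implementing the twist
`ρ(γ^a) = K γ^a K⁻¹ = (γ^a)†`. -/
structure IsTwistedGammaSystem (η : Fin (2 * m) → ℝ) (γ : Fin (2 * m) → SpinMat m)
    (K : SpinMat m) : Prop where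
  sign : ∀ a, η a = 1 ∨ η a = -1
  clifford : ∀ a b, γ a * γ b + γ b * γ a = if a = b then ((2 * η a : ℝ) : ℂ) • 1 else 0
  unitary : ∀ a, γ a ∈ Matrix.unitaryGroup (Fin (2 ^ m)) ℂ
  unitary_K : K ∈ Matrix.unitaryGroup (Fin (2 ^ m)) ℂ
  selfAdjoint_K : Kᴴ = K
  twist : ∀ a, K * γ a * K⁻¹ = (γ a)ᴴ

/-- The gamma matrices `γ_b = g_b γ^b` with index lowered by `g`. -/
def gammaLower (η : Fin (2 * m) → ℝ) (γ : Fin (2 * m) → SpinMat m) (b : Fin (2 * m)) : SpinMat m :=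
  (η b : ℂ) • γ b

/-- The twisted gamma matrices `γ̃^a = K γ^a`. Their frame index is lowered by `g_R`, which is the
identity matrix in the frame, so `γ̃_a` and `γ̃^a` are the same matrix. -/
def twistedGamma (K : SpinMat m) (γ : Fin (2 * m) → SpinMat m) (a : Fin (2 * m)) : SpinMat m :=
  K * γ a

/-- The coordinate components `γ^μ = e_a^μ γ^a` at the point with coordinates `y`. -/
def coordGamma (e : CoordMat m) (γ : Fin (2 * m) → SpinMat m) (y : CoordSpace m)
    (μ : Fin (2 * m)) : SpinMat m :=
  ∑ a, (e y μ a : ℂ) • γ a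

variable {M : Type*} [TopologicalSpace M] [ChartedSpace (CoordSpace m) M]

/-- The partial derivative `∂_μ ψ` of a spinor field in the chart `φ`. -/
def spinorPd (φ : OpenPartialHomeomorph M (CoordSpace m)) (μ : Fin (2 * m)) (ψ : M → Spinor m) :
    M → Spinor m :=
  fun x => pd μ (ψ ∘ φ.symm) (φ x)

/-- The term `(s/4) A^b_{μa} X^a Y_b ψ` for coefficients `A` depending on the coordinates. -/
def quarterTerm (φ : OpenPartialHomeomorph M (CoordSpace m)) (s : ℝ)
    (A : CoordSpace m → Fin (2 * m) → Fin (2 * m) → Fin (2 * m) → ℝ)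
    (X Y : Fin (2 * m) → SpinMat m) (μ : Fin (2 * m)) (ψ : M → Spinor m) : M → Spinor m :=
  fun x => (((s / 4 : ℝ) : ℂ) • ∑ a, ∑ b, (A (φ x) b μ a : ℂ) • (X a * Y b)) *ᵥ ψ x

/-- The spin connection `∇_μ = ∂_μ + (s/4) Γ^b_{μa} γ^a γ_b` of `g` in the frame `e`, with the sign
convention `s = ±1`. -/
def spinConnection (φ : OpenPartialHomeomorph M (CoordSpace m)) (g : FormField m M)
    (e : FrameField m M) (η : Fin (2 * m) → ℝ) (γ : Fin (2 * m) → SpinMat m) (s : ℝ)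
    (μ : Fin (2 * m)) (ψ : M → Spinor m) : M → Spinor m :=
  spinorPd φ μ ψ +
    quarterTerm φ s (frameChristoffel (formComp φ g) (frameComp φ e)) γ (gammaLower η γ) μ ψ

/-- The Dirac operator `D^K = -i γ^μ ∇_μ` of the pseudo-Riemannian spectral triple. -/
def pseudoDirac (φ : OpenPartialHomeomorph M (CoordSpace m)) (g : FormField m M)
    (e : FrameField m M) (η : Fin (2 * m) → ℝ) (γ : Fin (2 * m) → SpinMat m) (s : ℝ)
    (ψ : M → Spinor m) : M → Spinor m :=
  fun x => -Complex.I •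
    ∑ μ, coordGamma (frameComp φ e) γ (φ x) μ *ᵥ spinConnection φ g e η γ s μ ψ x

/-- The Dirac operator `D = K D^K` of the twisted spectral triple. -/
def twistedDirac (φ : OpenPartialHomeomorph M (CoordSpace m)) (g : FormField m M)
    (e : FrameField m M) (η : Fin (2 * m) → ℝ) (γ : Fin (2 * m) → SpinMat m) (K : SpinMat m)
    (s : ℝ) (ψ : M → Spinor m) : M → Spinor m :=
  fun x => K *ᵥ pseudoDirac φ g e η γ s ψ x

/-- The twisted spin connection `∇̃_μ = ∂_μ + (s/4) Γ̃^b_{μa} γ̃^a γ̃_b`. -/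
def twistedSpinConnection (φ : OpenPartialHomeomorph M (CoordSpace m)) (g : FormField m M)
    (e : FrameField m M) (γ : Fin (2 * m) → SpinMat m) (K : SpinMat m) (s : ℝ)
    (μ : Fin (2 * m)) (ψ : M → Spinor m) : M → Spinor m :=
  spinorPd φ μ ψ +
    quarterTerm φ s (twistedChristoffel (formComp φ g) (frameComp φ e))
      (twistedGamma K γ) (twistedGamma K γ) μ ψ

end Dirac

end

/-! ### Partial derivatives: locality and products with locally constant factors. -/

section PartialDerivatives

variable {m : ℕ}

/-! Being orthonormal for both metrics makes each `e_a` an eigenvector of `r` with eigenvalue `g_a`,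
and each `e^b` an eigencovector with eigenvalue `g_b`. As `r` has constant components, it passes
through `∂_μ` and can be replaced by signs. Two independent computations result. In `Γ_R`, the
inverse metric contributes `g_b`, and the two derivative terms in which the frame is contracted with
a metric slot contribute `g_a`; they match `g_a g_b Γ`. The inhomogeneous term is unaffected by `g_a
g_b`. Only the term differentiated along `e_a` differs, and it yields `K^b_{μa}`
(`twistedChristoffel_eq`). On spinors, `K γ^a = g_a γ^a K` and `K² = 1` give `γ̃^a γ̃_b = g_a γ^a
γ^b`. The signs in `Γ̃` cancel this factor, so the twisted connection is the spin connection of `g`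
itself, and multiplying `D^K` by `K` only turns `γ^μ` into `γ̃^μ`. -/

theorem pd_congr_of_eqOn {f h : CoordSpace m → ℝ} {U : Set (CoordSpace m)} (hU : IsOpen U)
    (hfh : ∀ z ∈ U, f z = h z) {y : CoordSpace m} (hy : y ∈ U) (μ : Fin (2 * m)) :
    pd μ f y = pd μ h y := by
  have : f =ᶠ[nhds y] h := Filter.eventuallyEq_of_mem (hU.mem_nhds hy) hfh
  rw [pd, pd, this.fderiv_eq]

theorem pd_const_mul {f : CoordSpace m → ℝ} {y : CoordSpace m} (hf : DifferentiableAt ℝ f y)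
    (c : ℝ) (μ : Fin (2 * m)) : pd μ (fun z => c * f z) y = c * pd μ f y := by
  simp [pd, fderiv_const_mul hf]

theorem pd_sum_mul {ι : Type*} [Fintype ι] {f k : ι → CoordSpace m → ℝ} {y : CoordSpace m}
    (hf : ∀ i, DifferentiableAt ℝ (f i) y) (hk : ∀ i, DifferentiableAt ℝ (k i) y)
    (μ : Fin (2 * m)) (hk0 : ∀ i, pd μ (k i) y = 0) :
    pd μ (fun z => ∑ i, f i z * k i z) y = ∑ i, pd μ (f i) y * k i y := by
  unfold pd at *
  rw [fderiv_fun_sum fun i _ => (hf i).fun_mul (hk i), _root_.sum_apply]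
  refine Finset.sum_congr rfl fun i _ => ?_
  rw [fderiv_fun_mul (hf i) (hk i)]
  simp [hk0, mul_comm]

end PartialDerivatives

/-! ### Matrix identities and the Christoffel comparison in coordinates. -/

section Coordinates

variable {m : ℕ}

/-- Components, over an open set `U` of coordinates, of a metric `G`, a parallel reflection `R`,
and a frame `E` which is orthonormal for `G` and for `G R`. -/
structure IsReflectedFrameData (G R E : CoordMat m) (η : Fin (2 * m) → ℝ)
    (U : Set (CoordSpace m)) : Prop where
  isOpen : IsOpen U
  sign : ∀ a, η a = 1 ∨ η a = -1
  symm : ∀ z ∈ U, (G z)ᵀ = G z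
  symm_reflected : ∀ z ∈ U, (G z * R z)ᵀ = G z * R z
  involutive : ∀ z ∈ U, R z * R z = 1
  orthonormal : ∀ z ∈ U, (E z)ᵀ * G z * E z = Matrix.diagonal η
  orthonormal_reflected : ∀ z ∈ U, (E z)ᵀ * (G z * R z) * E z = 1
  parallel : ReflectionIntegrable R U
  differentiable_metric : ∀ z ∈ U, ∀ μ ν, DifferentiableAt ℝ (fun z => G z μ ν) z
  differentiable_reflection : ∀ z ∈ U, ∀ μ ν, DifferentiableAt ℝ (fun z => R z μ ν) z
  differentiable_frame : ∀ z ∈ U, ∀ μ ν, DifferentiableAt ℝ (fun z => E z μ ν) z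

namespace IsReflectedFrameData

variable {G R E : CoordMat m} {η : Fin (2 * m) → ℝ} {U : Set (CoordSpace m)}
  {y : CoordSpace m}

/-- Orthonormality for `g_R` exhibits the inverse of `E` as a polynomial in the entries of `E`, `G`
and `R`. -/
theorem coframe_eq (h : IsReflectedFrameData G R E η U) (hy : y ∈ U) :
    coframe E y = (E y)ᵀ * (G y * R y) :=
  Matrix.inv_eq_left_inv (h.orthonormal_reflected y hy)

theorem coframe_mul_frame (h : IsReflectedFrameData G R E η U) (hy : y ∈ U) :
    coframe E y * E y = 1 := by
  rw [h.coframe_eq hy, h.orthonormal_reflected y hy]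

theorem frame_mul_coframe (h : IsReflectedFrameData G R E η U) (hy : y ∈ U) :
    E y * coframe E y = 1 :=
  mul_eq_one_comm.mp (h.coframe_mul_frame hy)

/-- The eigencovector relation `e^b ∘ r = g_b e^b`: since `R² = 1`, the left side is `Eᵀ G = (Eᵀ G
E) E⁻¹`. -/
theorem coframe_mul_reflection (h : IsReflectedFrameData G R E η U) (hy : y ∈ U) :
    coframe E y * R y = Matrix.diagonal η * coframe E y := by
  rw [← h.orthonormal y hy, Matrix.mul_assoc _ (E y), h.frame_mul_coframe hy, h.coframe_eq hy,
    Matrix.mul_one, Matrix.mul_assoc, Matrix.mul_assoc, h.involutive y hy, Matrix.mul_one]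

theorem reflection_mul_frame (h : IsReflectedFrameData G R E η U) (hy : y ∈ U) :
    R y * E y = E y * Matrix.diagonal η := by
  calc R y * E y = E y * (coframe E y * R y) * E y := by
        rw [← Matrix.mul_assoc, h.frame_mul_coframe hy, Matrix.one_mul]
    _ = E y * Matrix.diagonal η := by
        rw [h.coframe_mul_reflection hy, Matrix.mul_assoc, Matrix.mul_assoc,
          h.coframe_mul_frame hy, Matrix.mul_one]

theorem reflected_inv (h : IsReflectedFrameData G R E η U) (hy : y ∈ U) :
    (G y * R y)⁻¹ = R y * (G y)⁻¹ := by
  rw [Matrix.mul_inv_rev, Matrix.inv_eq_left_inv (h.involutive y hy)]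

/-- Raising an index with `g_R` instead of `g` costs the sign `g_b`, because the inverse of `G R` is
`R G⁻¹` and `R` then acts on `e^b`. -/
theorem coframe_reflected_inv (h : IsReflectedFrameData G R E η U) (hy : y ∈ U)
    (b κ : Fin (2 * m)) :
    ∑ l, coframe E y b l * (G y * R y)⁻¹ l κ = η b * ∑ l, coframe E y b l * (G y)⁻¹ l κ := by
  have hmat : coframe E y * (G y * R y)⁻¹ =
      Matrix.diagonal η * (coframe E y * (G y)⁻¹) := by
    rw [h.reflected_inv hy, ← Matrix.mul_assoc, h.coframe_mul_reflection hy, Matrix.mul_assoc]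
  have hentry := congrFun₂ hmat b κ
  rwa [Matrix.diagonal_mul, Matrix.mul_apply, Matrix.mul_apply] at hentry

theorem sum_reflection_frame (h : IsReflectedFrameData G R E η U) (hy : y ∈ U)
    (σ a : Fin (2 * m)) : ∑ ν, R y σ ν * E y ν a = η a * E y σ a := by
  have hentry := congrFun₂ (h.reflection_mul_frame hy) σ a
  rw [Matrix.mul_diagonal, Matrix.mul_apply] at hentry
  rw [hentry, mul_comm]

theorem frameSign_eq (h : IsReflectedFrameData G R E η U) (hy : y ∈ U) (a : Fin (2 * m)) :
    frameSign G E a y = η a := by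
  have := congrFun₂ (h.orthonormal y hy) a a
  rw [Matrix.diagonal_apply_eq, Matrix.mul_apply] at this
  rw [← this, frameSign, Finset.sum_comm]
  simp only [Matrix.mul_apply, Matrix.transpose_apply, Finset.sum_mul]
  exact Finset.sum_congr rfl fun ν _ => Finset.sum_congr rfl fun μ _ => by ring

theorem pd_frameSign (h : IsReflectedFrameData G R E η U) (hy : y ∈ U) (a μ : Fin (2 * m)) :
    pd μ (frameSign G E a) y = 0 := by
  rw [pd_congr_of_eqOn h.isOpen (fun z hz => h.frameSign_eq hz a) hy]
  simp [pd]

theorem pd_metric_symm (h : IsReflectedFrameData G R E η U) (hy : y ∈ U)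
    (κ μ ν : Fin (2 * m)) : pd κ (fun z => G z μ ν) y = pd κ (fun z => G z ν μ) y :=
  pd_congr_of_eqOn h.isOpen (fun z hz => congrFun₂ (h.symm z hz) ν μ) hy κ

theorem pd_reflected_symm (h : IsReflectedFrameData G R E η U) (hy : y ∈ U)
    (κ μ ν : Fin (2 * m)) :
    pd κ (fun z => (G z * R z) μ ν) y = pd κ (fun z => (G z * R z) ν μ) y :=
  pd_congr_of_eqOn h.isOpen (fun z hz => congrFun₂ (h.symm_reflected z hz) ν μ) hy κ

/-- Parallelism moves `R` outside the derivative, where it meets its eigenvector `e_a`. -/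
theorem frame_pd_reflected (h : IsReflectedFrameData G R E η U) (hy : y ∈ U)
    (κ μ a : Fin (2 * m)) :
    ∑ ν, E y ν a * pd κ (fun z => (G z * R z) μ ν) y =
      η a * ∑ ν, E y ν a * pd κ (fun z => G z μ ν) y := by
  have hpd (ν : Fin (2 * m)) : pd κ (fun z => (G z * R z) μ ν) y =
      ∑ σ, pd κ (fun z => G z μ σ) y * R y σ ν := by
    simp only [Matrix.mul_apply]
    exact pd_sum_mul (fun _ => h.differentiable_metric y hy _ _)
      (fun _ => h.differentiable_reflection y hy _ _) κ fun _ => h.parallel y hy _ _ _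
  simp only [hpd, Finset.mul_sum]
  rw [Finset.sum_comm]
  refine Finset.sum_congr rfl fun σ _ => ?_
  rw [← mul_assoc, ← h.sum_reflection_frame hy, Finset.sum_mul]
  exact Finset.sum_congr rfl fun ν _ => by ring

theorem reflectedFrameDeriv_eq (h : IsReflectedFrameData G R E η U) (hy : y ∈ U)
    (a : Fin (2 * m)) (f : CoordSpace m → ℝ) :
    reflectedFrameDeriv R E a f y = η a * frameDeriv E a f y := by
  rw [reflectedFrameDeriv, Finset.sum_comm, frameDeriv, Finset.mul_sum]
  refine Finset.sum_congr rfl fun σ _ => ?_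
  rw [← mul_assoc, ← h.sum_reflection_frame hy, Finset.sum_mul]
  exact Finset.sum_congr rfl fun ν _ => by ring

/-- The formula of `coframe_eq` avoids differentiating a matrix inverse. -/
theorem differentiableAt_coframe (h : IsReflectedFrameData G R E η U) (hy : y ∈ U)
    (b ν : Fin (2 * m)) : DifferentiableAt ℝ (fun z => coframe E z b ν) y := by
  have heq : (fun z => coframe E z b ν) =ᶠ[nhds y]
      fun z => ∑ l, E z l b * ∑ κ, G z l κ * R z κ ν :=
    Filter.eventuallyEq_of_mem (h.isOpen.mem_nhds hy) fun z hz => by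
      simp [h.coframe_eq hz, Matrix.mul_apply]
  refine DifferentiableAt.congr_of_eventuallyEq ?_ heq
  exact DifferentiableAt.fun_sum fun l _ => (h.differentiable_frame y hy _ _).mul
    (DifferentiableAt.fun_sum fun κ _ => (h.differentiable_metric y hy _ _).mul
      (h.differentiable_reflection y hy _ _))

/-- Differentiating `e^b R = g_b e^b` with `R` constant and contracting with `e_a` gives `g_b X =
g_a X` for the inhomogeneous term `X`. Hence `X` vanishes unless the two signs agree, and `g_a g_b`
acts trivially on it. -/
theorem sign_mul_frame_pd_coframe (h : IsReflectedFrameData G R E η U) (hy : y ∈ U)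
    (μ a b : Fin (2 * m)) :
    η a * η b * ∑ ν, E y ν a * pd μ (fun z => coframe E z b ν) y =
      ∑ ν, E y ν a * pd μ (fun z => coframe E z b ν) y := by
  have hpd (ν : Fin (2 * m)) : η b * pd μ (fun z => coframe E z b ν) y =
      ∑ σ, pd μ (fun z => coframe E z b σ) y * R y σ ν := by
    rw [← pd_const_mul (h.differentiableAt_coframe hy _ _),
      ← pd_sum_mul (fun _ => h.differentiableAt_coframe hy _ _)
        (fun _ => h.differentiable_reflection y hy _ _) μ fun _ => h.parallel y hy _ _ _]
    refine pd_congr_of_eqOn h.isOpen (fun z hz => ?_) hy μ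
    have := congrFun₂ (h.coframe_mul_reflection hz) b ν
    rw [Matrix.diagonal_mul, Matrix.mul_apply] at this
    exact this.symm
  have hcomm : η b * ∑ ν, E y ν a * pd μ (fun z => coframe E z b ν) y =
      η a * ∑ ν, E y ν a * pd μ (fun z => coframe E z b ν) y := by
    simp only [Finset.mul_sum, mul_left_comm (η b), hpd]
    rw [Finset.sum_comm]
    refine Finset.sum_congr rfl fun σ _ => ?_
    rw [← mul_assoc, ← h.sum_reflection_frame hy, Finset.sum_mul]
    exact Finset.sum_congr rfl fun ν _ => by ring
  rw [mul_assoc, hcomm, ← mul_assoc]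
  rcases h.sign a with ha | ha <;> simp [ha]

end IsReflectedFrameData

/-- Regrouped so that each derivative term is already contracted with `e_a`: the outer two through a
metric slot, the middle one through the direction of differentiation. The reflection affects these
two kinds differently. -/
theorem frameChristoffel_eq (g e : CoordMat m) (y : CoordSpace m) (b μ a : Fin (2 * m)) :
    frameChristoffel g e y b μ a =
      (1 / 2) * ∑ κ, (∑ l, coframe e y b l * (g y)⁻¹ l κ) *
        (∑ ν, e y ν a * pd μ (fun z => g z ν κ) y + frameDeriv e a (fun z => g z μ κ) y -
          ∑ ν, e y ν a * pd κ (fun z => g z μ ν) y) -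
      ∑ ν, e y ν a * pd μ (fun z => coframe e z b ν) y := by
  rw [frameChristoffel]
  congr 1
  simp only [christoffel, frameDeriv, ← Finset.sum_add_distrib, ← Finset.sum_sub_distrib,
    Finset.mul_sum, Finset.sum_mul]
  calc _ = ∑ ν, ∑ κ, ∑ l, _ := Finset.sum_congr rfl fun ν _ => Finset.sum_comm
    _ = _ := Finset.sum_comm
    _ = _ := Finset.sum_congr rfl fun κ _ => Finset.sum_congr rfl fun ν _ =>
      Finset.sum_congr rfl fun l _ => by ring

/-- All terms agree except the middle one, which is `g_a ∂_a g_{μκ} = ∂_{ra} g_{μκ}` on one side and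
`∂_a g^R_{μκ}` on the other. The summand `∂_μ g_a` is zero, the signs being constant. -/
theorem IsReflectedFrameData.twistedChristoffel_eq {G R E : CoordMat m} {η : Fin (2 * m) → ℝ}
    {U : Set (CoordSpace m)} (h : IsReflectedFrameData G R E η U) {GR : CoordMat m}
    (hGR : ∀ z ∈ U, GR z = G z * R z) {y : CoordSpace m} (hy : y ∈ U) (b μ a : Fin (2 * m)) :
    twistedChristoffel G E y b μ a =
      frameChristoffel GR E y b μ a + correctionTerm G GR R E y b μ a := by
  have hpd (κ μ ν : Fin (2 * m)) :
      pd κ (fun z => GR z μ ν) y = pd κ (fun z => (G z * R z) μ ν) y :=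
    pd_congr_of_eqOn h.isOpen (fun z hz => by rw [hGR z hz]) hy κ
  -- Symmetry brings the contracted index to the second slot, the one on which `R` acts in `G R`.
  have hfirst (κ : Fin (2 * m)) : ∑ ν, E y ν a * pd μ (fun z => GR z ν κ) y =
      η a * ∑ ν, E y ν a * pd μ (fun z => G z ν κ) y := by
    simp only [hpd, h.pd_reflected_symm hy _ _ κ, h.frame_pd_reflected hy,
      h.pd_metric_symm hy _ _ κ]
  have hlast (κ : Fin (2 * m)) : ∑ ν, E y ν a * pd κ (fun z => GR z μ ν) y =
      η a * ∑ ν, E y ν a * pd κ (fun z => G z μ ν) y := by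
    simp only [hpd, h.frame_pd_reflected hy]
  rw [twistedChristoffel, correctionTerm, h.frameSign_eq hy, h.frameSign_eq hy,
    h.pd_frameSign hy, frameChristoffel_eq, frameChristoffel_eq, mul_sub,
    h.sign_mul_frame_pd_coframe hy]
  simp only [hfirst, hlast, hGR y hy, h.coframe_reflected_inv hy, h.reflectedFrameDeriv_eq hy,
    sub_zero]
  rw [sub_add_eq_add_sub]
  congr 1
  simp only [Finset.mul_sum, ← Finset.sum_add_distrib]
  refine Finset.sum_congr rfl fun κ _ => ?_
  simp only [← Finset.mul_sum]
  ring

end Coordinates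

/-! ### Clifford algebra of the twisted gamma matrices. -/

section Spinors

variable {m : ℕ}

namespace IsTwistedGammaSystem

variable {η : Fin (2 * m) → ℝ} {γ : Fin (2 * m) → SpinMat m} {K : SpinMat m}

theorem sign_mul_self (h : IsTwistedGammaSystem η γ K) (a : Fin (2 * m)) :
    (η a : ℂ) * η a = 1 := by
  rcases h.sign a with ha | ha <;> simp [ha]

theorem K_mul_self (h : IsTwistedGammaSystem η γ K) : K * K = 1 := by
  have := Matrix.mem_unitaryGroup_iff.mp h.unitary_K
  rwa [Matrix.star_eq_conjTranspose, h.selfAdjoint_K] at this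

theorem mul_self (h : IsTwistedGammaSystem η γ K) (a : Fin (2 * m)) :
    γ a * γ a = (η a : ℂ) • (1 : SpinMat m) := by
  have h2 := h.clifford a a
  rw [if_pos rfl, ← two_smul ℂ (γ a * γ a)] at h2
  push_cast at h2
  rw [mul_smul] at h2
  exact smul_right_injective _ (two_ne_zero (α := ℂ)) h2

/-- By unitarity the adjoint is the inverse, and `(γ^a)² = g_a` with `g_a = ±1` makes the inverse
`g_a γ^a`. -/
theorem conjTranspose_eq (h : IsTwistedGammaSystem η γ K) (a : Fin (2 * m)) :
    (γ a)ᴴ = (η a : ℂ) • γ a := by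
  have hu := Matrix.mem_unitaryGroup_iff'.mp (h.unitary a)
  rw [Matrix.star_eq_conjTranspose] at hu
  calc (γ a)ᴴ = (γ a)ᴴ * (((η a : ℂ) * η a) • (1 : SpinMat m)) := by
        rw [h.sign_mul_self, one_smul, Matrix.mul_one]
    _ = (η a : ℂ) • ((γ a)ᴴ * γ a * γ a) := by
        rw [mul_smul, ← h.mul_self, Matrix.mul_smul, Matrix.mul_assoc]
    _ = (η a : ℂ) • γ a := by rw [hu, Matrix.one_mul]

/-- The twist thus says that `K` commutes or anticommutes with `γ^a` according to the sign. -/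
theorem K_mul (h : IsTwistedGammaSystem η γ K) (a : Fin (2 * m)) :
    K * γ a = (η a : ℂ) • (γ a * K) := by
  have ht := h.twist a
  rw [Matrix.inv_eq_left_inv h.K_mul_self, h.conjTranspose_eq] at ht
  calc K * γ a = K * γ a * K * K := by rw [Matrix.mul_assoc _ K K, h.K_mul_self, Matrix.mul_one]
    _ = (η a : ℂ) • (γ a * K) := by rw [ht, Matrix.smul_mul]

theorem twistedGamma_mul_twistedGamma (h : IsTwistedGammaSystem η γ K) (a b : Fin (2 * m)) :
    twistedGamma K γ a * twistedGamma K γ b = (η a : ℂ) • (γ a * γ b) := by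
  rw [twistedGamma, twistedGamma, h.K_mul a, Matrix.smul_mul, Matrix.mul_assoc,
    ← Matrix.mul_assoc K K, h.K_mul_self, Matrix.one_mul]

end IsTwistedGammaSystem

theorem mul_coordGamma (e : CoordMat m) (γ : Fin (2 * m) → SpinMat m) (K : SpinMat m)
    (y : CoordSpace m) (μ : Fin (2 * m)) :
    K * coordGamma e γ y μ = coordGamma e (twistedGamma K γ) y μ := by
  simp [coordGamma, twistedGamma, Finset.mul_sum]

end Spinors

theorem quarterTerm_add {m : ℕ} {M : Type*} [TopologicalSpace M]
    (φ : OpenPartialHomeomorph M (CoordSpace m)) (s : ℝ)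
    {A B C : CoordSpace m → Fin (2 * m) → Fin (2 * m) → Fin (2 * m) → ℝ}
    (X Y : Fin (2 * m) → SpinMat m) (μ : Fin (2 * m)) (ψ : M → Spinor m) (x : M)
    (h : ∀ b a, A (φ x) b μ a = B (φ x) b μ a + C (φ x) b μ a) :
    quarterTerm φ s A X Y μ ψ x = quarterTerm φ s B X Y μ ψ x + quarterTerm φ s C X Y μ ψ x := by
  simp only [quarterTerm, h, ← Matrix.add_mulVec, ← smul_add, ← Finset.sum_add_distrib,
    ← add_smul, Complex.ofReal_add]

/-! ### Dirac operators, and passage from tensor fields to their chart components. -/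

section Manifold

variable {m : ℕ} {M : Type*} [TopologicalSpace M] [ChartedSpace (CoordSpace m) M]

theorem twistedSpinConnection_eq_spinConnection (φ : OpenPartialHomeomorph M (CoordSpace m))
    (g : FormField m M) (e : FrameField m M) {η : Fin (2 * m) → ℝ}
    {γ : Fin (2 * m) → SpinMat m} {K : SpinMat m} (h : IsTwistedGammaSystem η γ K) (s : ℝ)
    (μ : Fin (2 * m)) (ψ : M → Spinor m) (x : M)
    (hsign : ∀ a, frameSign (formComp φ g) (frameComp φ e) a (φ x) = η a) :
    twistedSpinConnection φ g e γ K s μ ψ x = spinConnection φ g e η γ s μ ψ x := by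
  rw [twistedSpinConnection, spinConnection, Pi.add_apply, Pi.add_apply]
  congr 1
  unfold quarterTerm
  congr 2
  refine Finset.sum_congr rfl fun a _ => Finset.sum_congr rfl fun b _ => ?_
  rw [h.twistedGamma_mul_twistedGamma, gammaLower, Matrix.mul_smul, smul_smul, smul_smul,
    twistedChristoffel, hsign, hsign]
  congr 1
  push_cast
  -- The factor `g_a` of `Γ̃` squares to one against that of `γ̃^a γ̃^b`; the remaining `g_b` lowers
  -- the index of `γ_b`.
  linear_combination (η b : ℂ) * frameChristoffel (formComp φ g) (frameComp φ e) (φ x) b μ a *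
    h.sign_mul_self a

theorem twistedDirac_eq (φ : OpenPartialHomeomorph M (CoordSpace m))
    (g : FormField m M) (e : FrameField m M) {η : Fin (2 * m) → ℝ}
    {γ : Fin (2 * m) → SpinMat m} {K : SpinMat m} (h : IsTwistedGammaSystem η γ K) (s : ℝ)
    (ψ : M → Spinor m) (x : M)
    (hsign : ∀ a, frameSign (formComp φ g) (frameComp φ e) a (φ x) = η a) :
    twistedDirac φ g e η γ K s ψ x =
      -Complex.I • ∑ μ, coordGamma (frameComp φ e) (twistedGamma K γ) (φ x) μ *ᵥ
        twistedSpinConnection φ g e γ K s μ ψ x := by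
  simp only [twistedDirac, pseudoDirac, Matrix.mulVec_smul, Matrix.mulVec_sum,
    Matrix.mulVec_mulVec, mul_coordGamma,
    twistedSpinConnection_eq_spinConnection φ g e h s _ ψ x hsign]

variable {φ : OpenPartialHomeomorph M (CoordSpace m)}

theorem mdifferentiable_of_mem_maximalAtlas_infty [IsManifold (𝓡 (2 * m)) ∞ M]
    (hφ : φ ∈ IsManifold.maximalAtlas (𝓡 (2 * m)) ∞ M) :
    φ.MDifferentiable (𝓡 (2 * m)) 𝓘(ℝ, CoordSpace m) :=
  ⟨(contMDiffOn_of_mem_maximalAtlas hφ).mdifferentiableOn (by simp),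
    (contMDiffOn_symm_of_mem_maximalAtlas hφ).mdifferentiableOn (by simp)⟩

theorem coordComp_sum_smul (φ : OpenPartialHomeomorph M (CoordSpace m)) (μ : Fin (2 * m))
    (y : CoordSpace m) {ι : Type*} [Fintype ι] (c : ι → ℝ)
    (v : ι → TangentSpace (𝓡 (2 * m)) (φ.symm y)) :
    coordComp φ μ y (∑ i, c i • v i) = ∑ i, c i * coordComp φ μ y (v i) := by
  -- Repackages `coordComp` as a linear map so that linearity applies.
  let L : TangentSpace (𝓡 (2 * m)) (φ.symm y) →ₗ[ℝ] ℝ :=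
    (EuclideanSpace.proj μ : CoordSpace m →L[ℝ] ℝ).toLinearMap ∘ₗ
      (mfderiv (𝓡 (2 * m)) 𝓘(ℝ, CoordSpace m) φ (φ.symm y)).toLinearMap
  change L (∑ i, c i • v i) = ∑ i, c i * L (v i)
  simp only [map_sum, map_smul, smul_eq_mul]

theorem coordComp_coordVec [IsManifold (𝓡 (2 * m)) ∞ M]
    (hφ : φ ∈ IsManifold.maximalAtlas (𝓡 (2 * m)) ∞ M) {y : CoordSpace m} (hy : y ∈ φ.target)
    (μ ν : Fin (2 * m)) :
    coordComp φ μ y (coordVec φ ν y) = (1 : Matrix (Fin (2 * m)) (Fin (2 * m)) ℝ) μ ν := by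
  have hv : mfderiv (𝓡 (2 * m)) 𝓘(ℝ, CoordSpace m) φ (φ.symm y) (coordVec φ ν y) =
      (EuclideanSpace.single ν (1 : ℝ) : CoordSpace m) :=
    DFunLike.congr_fun ((mdifferentiable_of_mem_maximalAtlas_infty hφ).comp_symm_deriv hy)
      (EuclideanSpace.single ν (1 : ℝ) : CoordSpace m)
  have hμ := congrArg (fun w : CoordSpace m => w μ) hv
  refine hμ.trans ?_
  simp [Matrix.one_apply]

/-- The derivatives of the chart and its inverse compose to the identity; this turns pointwise
tensor identities into matrix ones. -/
theorem sum_coordComp_smul_coordVec [IsManifold (𝓡 (2 * m)) ∞ M]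
    (hφ : φ ∈ IsManifold.maximalAtlas (𝓡 (2 * m)) ∞ M) {y : CoordSpace m} (hy : y ∈ φ.target)
    (v : TangentSpace (𝓡 (2 * m)) (φ.symm y)) :
    ∑ μ, coordComp φ μ y v • coordVec φ μ y = v := by
  have hinv := (mdifferentiable_of_mem_maximalAtlas_infty hφ).symm_comp_deriv (φ.map_target hy)
  rw [φ.right_inv hy] at hinv
  set w : CoordSpace m := mfderiv (𝓡 (2 * m)) 𝓘(ℝ, CoordSpace m) φ (φ.symm y) v with hw
  have hsum : ∑ μ, w μ • EuclideanSpace.single μ (1 : ℝ) = w := by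
    simpa using (EuclideanSpace.basisFun (Fin (2 * m)) ℝ).sum_repr w
  calc ∑ μ, coordComp φ μ y v • coordVec φ μ y
      = mfderiv 𝓘(ℝ, CoordSpace m) (𝓡 (2 * m)) φ.symm y
          (∑ μ, w μ • EuclideanSpace.single μ (1 : ℝ) : CoordSpace m) := by
        simp only [coordVec, coordComp]
        exact ((map_sum _ _ _).trans (Finset.sum_congr rfl fun μ _ => map_smul _ _ _)).symm
    _ = v := by
        rw [hsum]
        exact DFunLike.congr_fun hinv v

theorem formComp_bilin (φ : OpenPartialHomeomorph M (CoordSpace m)) (g : FormField m M)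
    (y : CoordSpace m) {ι κ : Type*} [Fintype ι] [Fintype κ]
    (A : Matrix (Fin (2 * m)) ι ℝ) (B : Matrix (Fin (2 * m)) κ ℝ) (i : ι) (j : κ) :
    (Aᵀ * formComp φ g y * B) i j =
      g (φ.symm y) (∑ μ, A μ i • coordVec φ μ y) (∑ ν, B ν j • coordVec φ ν y) := by
  simp only [Matrix.mul_apply, Matrix.transpose_apply, formComp, Matrix.of_apply, map_sum,
    LinearMap.sum_apply, map_smul, LinearMap.smul_apply, smul_eq_mul, Finset.sum_mul,
    Finset.mul_sum]
  exact Finset.sum_congr rfl fun ν _ => Finset.sum_congr rfl fun μ _ => by ring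

theorem endComp_mul_endComp [IsManifold (𝓡 (2 * m)) ∞ M]
    (hφ : φ ∈ IsManifold.maximalAtlas (𝓡 (2 * m)) ∞ M) {r : EndField m M}
    (hr : ∀ x v, r x (r x v) = v) {y : CoordSpace m} (hy : y ∈ φ.target) :
    endComp φ r y * endComp φ r y = 1 := by
  ext μ ν
  rw [← coordComp_coordVec hφ hy μ ν, ← hr (φ.symm y) (coordVec φ ν y),
    ← sum_coordComp_smul_coordVec hφ hy (r (φ.symm y) (coordVec φ ν y)), map_sum]
  simp only [map_smul, coordComp_sum_smul, Matrix.mul_apply, endComp, Matrix.of_apply]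
  exact Finset.sum_congr rfl fun σ _ => mul_comm _ _

theorem formComp_reflectedMetric [IsManifold (𝓡 (2 * m)) ∞ M]
    (hφ : φ ∈ IsManifold.maximalAtlas (𝓡 (2 * m)) ∞ M) (g : FormField m M) (r : EndField m M)
    {y : CoordSpace m} (hy : y ∈ φ.target) :
    formComp φ (reflectedMetric g r) y = formComp φ g y * endComp φ r y := by
  ext μ ν
  have hexp : g (φ.symm y) (coordVec φ μ y) (r (φ.symm y) (coordVec φ ν y)) =
      ∑ σ, coordComp φ σ y (r (φ.symm y) (coordVec φ ν y)) *
        g (φ.symm y) (coordVec φ μ y) (coordVec φ σ y) := by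
    conv_lhs => rw [← sum_coordComp_smul_coordVec hφ hy (r (φ.symm y) (coordVec φ ν y)), map_sum]
    simp only [map_smul, smul_eq_mul]
  simp only [Matrix.mul_apply, formComp, endComp, Matrix.of_apply, reflectedMetric,
    LinearMap.compl₂_apply, hexp]
  exact Finset.sum_congr rfl fun σ _ => mul_comm _ _

theorem frameComp_gram [IsManifold (𝓡 (2 * m)) ∞ M]
    (hφ : φ ∈ IsManifold.maximalAtlas (𝓡 (2 * m)) ∞ M) (g : FormField m M) (e : FrameField m M)
    {y : CoordSpace m} (hy : y ∈ φ.target) (a b : Fin (2 * m)) :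
    ((frameComp φ e y)ᵀ * formComp φ g y * frameComp φ e y) a b =
      g (φ.symm y) (e a (φ.symm y)) (e b (φ.symm y)) := by
  rw [formComp_bilin]
  simp only [frameComp, Matrix.of_apply, sum_coordComp_smul_coordVec hφ hy]

theorem formComp_transpose {h : FormField m M} (hh : ∀ x u v, h x u v = h x v u)
    (φ : OpenPartialHomeomorph M (CoordSpace m)) (y : CoordSpace m) :
    (formComp φ h y)ᵀ = formComp φ h y := by
  ext μ ν
  exact hh _ _ _

/-- An isometric involution is self-adjoint: `g(u, rv) = g(ru, r²v) = g(ru, v)`. -/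
theorem reflectedMetric_symm {g : FormField m M} (hg : IsPseudoRiemannianMetric g)
    {r : EndField m M} (hr : IsSpacelikeReflection g r) (x : M)
    (u v : TangentSpace (𝓡 (2 * m)) x) :
    reflectedMetric g r x u v = reflectedMetric g r x v u := by
  simp only [reflectedMetric, LinearMap.compl₂_apply]
  rw [← hr.isometry, hr.involutive, hg.symm]

theorem isReflectedFrameData [IsManifold (𝓡 (2 * m)) ∞ M]
    {g : FormField m M} (hg : IsPseudoRiemannianMetric g)
    {r : EndField m M} (hr : IsSpacelikeReflection g r)
    (hφ : φ ∈ IsManifold.maximalAtlas (𝓡 (2 * m)) ∞ M)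
    (hint : ReflectionIntegrable (endComp φ r) φ.target)
    {η : Fin (2 * m) → ℝ} (hη : ∀ a, η a = 1 ∨ η a = -1)
    {e : FrameField m M} (he : IsOrthonormalFrame φ g r η e) :
    IsReflectedFrameData (formComp φ g) (endComp φ r) (frameComp φ e) η φ.target where
  isOpen := φ.open_target
  sign := hη
  symm z _ := formComp_transpose hg.symm φ z
  symm_reflected z hz := by
    rw [← formComp_reflectedMetric hφ g r hz]
    exact formComp_transpose (reflectedMetric_symm hg hr) φ z
  involutive z hz := endComp_mul_endComp hφ hr.involutive hz
  orthonormal z hz := by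
    ext a b
    rw [frameComp_gram hφ g e hz, he.orthonormal _ (φ.map_target hz), Matrix.diagonal_apply]
  orthonormal_reflected z hz := by
    ext a b
    rw [← formComp_reflectedMetric hφ g r hz, frameComp_gram hφ _ e hz,
      he.orthonormal_reflected _ (φ.map_target hz), Matrix.one_apply]
  parallel := hint
  differentiable_metric z hz μ ν :=
    ((hg.smooth φ hφ μ ν).differentiableOn (by simp)).differentiableAt (φ.open_target.mem_nhds hz)
  differentiable_reflection z hz μ ν :=
    ((hr.smooth φ hφ μ ν).differentiableOn (by simp)).differentiableAt (φ.open_target.mem_nhds hz)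
  differentiable_frame z hz μ a :=
    ((he.smooth μ a).differentiableOn (by simp)).differentiableAt (φ.open_target.mem_nhds hz)

end Manifold

theorem mainTheorem5 (m : ℕ) (M : Type*) [TopologicalSpace M] [ChartedSpace (CoordSpace m) M]
    [IsManifold (𝓡 (2 * m)) ∞ M]
    (g : FormField m M) (hg : IsPseudoRiemannianMetric g)
    (r : EndField m M) (hr : IsSpacelikeReflection g r)
    (φ : OpenPartialHomeomorph M (CoordSpace m))
    (hφ : φ ∈ IsManifold.maximalAtlas (𝓡 (2 * m)) ∞ M)
    (hint : ReflectionIntegrable (endComp φ r) φ.target)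
    (η : Fin (2 * m) → ℝ) (e : FrameField m M) (he : IsOrthonormalFrame φ g r η e)
    (γ : Fin (2 * m) → SpinMat m) (K : SpinMat m) (hγ : IsTwistedGammaSystem η γ K)
    (s : ℝ) (hs : s = 1 ∨ s = -1)
    (ψ : M → Spinor m)
    (hψ : ContMDiffOn (𝓡 (2 * m)) 𝓘(ℝ, Spinor m) ∞ ψ φ.source)
    (x : M) (hx : x ∈ φ.source) :
    twistedDirac φ g e η γ K s ψ x =
        -Complex.I • ∑ μ, coordGamma (frameComp φ e) (twistedGamma K γ) (φ x) μ *ᵥ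
          twistedSpinConnection φ g e γ K s μ ψ x ∧
      ∀ μ, twistedSpinConnection φ g e γ K s μ ψ x =
        spinorPd φ μ ψ x +
          quarterTerm φ s
            (frameChristoffel (formComp φ (reflectedMetric g r)) (frameComp φ e))
            (twistedGamma K γ) (twistedGamma K γ) μ ψ x +
          quarterTerm φ s
            (correctionTerm (formComp φ g) (formComp φ (reflectedMetric g r)) (endComp φ r)
              (frameComp φ e))
            (twistedGamma K γ) (twistedGamma K γ) μ ψ x := by
  have hframe := isReflectedFrameData hg hr hφ hint hγ.sign he
  have hy : φ x ∈ φ.target := φ.map_source hx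
  refine ⟨twistedDirac_eq φ g e hγ s ψ x (hframe.frameSign_eq hy), fun μ => ?_⟩
  rw [add_assoc, ← quarterTerm_add φ s _ _ μ ψ x fun b a =>
    hframe.twistedChristoffel_eq (fun z hz => formComp_reflectedMetric hφ g r hz) hy b μ a]
  rfl
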